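/- For $P \subseteq \mathbb{R}^n$, an extended formulation of $P$ of size $r$ consists of a polyhedron $Q=\{z\in\mathbb{R}^m : Cz\le c,\ Dz=d\}$, for some $m\in\mathbb{Z}_{\ge 0}$, where $C$ has $r$ rows (and $D$ has any finite number of rows), together with a linear map $p:\mathbb{R}^m\to\mathbb{R}^n$ such that $p(Q)=P$. For a polytope $P$, the extension complexity $\mathrm{xc}(P)$ is the smallest size of an extended formulation of $P$. For a matroid $M=(\{1,\dots,n\},\mathcal{I})$, let $\mathrm{conv}(\chi(\mathcal{I}))\subseteq\mathbb{R}^n$ be its independence polytope, the convex hull of the characteristic vectors of its independent sets. There exist a family of matroids $M_n=(\{1,\dots,n\},\mathcal{I}_n)$, $n\ge 1$, and a constant $C>0$ such that for every $n\ge 1$ $$\mathrm{xc}\bigl(\mathrm{conv}(\chi(\mathcal{I}_n))\bigr)\ \ge\ C\cdot\frac{2^{n/2}}{n^{5/4}\,\log(2n)}.$$ -/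

import Mathlib

/-- The polyhedron `{z ∈ ℝᵐ | C z ≤ c, D z = d}` given by `r` linear inequalities
and `e` linear equations. -/
def linearSystemSolutions {m r e : ℕ} (C : Matrix (Fin r) (Fin m) ℝ) (c : Fin r → ℝ)
    (D : Matrix (Fin e) (Fin m) ℝ) (d : Fin e → ℝ) : Set (Fin m → ℝ) :=
  {z | (∀ i, (C.mulVec z) i ≤ c i) ∧ D.mulVec z = d}

/-- `P ⊆ ℝⁿ` has an extended formulation of size `r`: it is the image, under a linear map
`ℝᵐ → ℝⁿ` for some `m`, of a polyhedron described by `r` linear inequalities and any number of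
linear equations. -/
def HasExtendedFormulation {n : ℕ} (P : Set (Fin n → ℝ)) (r : ℕ) : Prop :=
  ∃ (m e : ℕ) (C : Matrix (Fin r) (Fin m) ℝ) (c : Fin r → ℝ)
    (D : Matrix (Fin e) (Fin m) ℝ) (d : Fin e → ℝ)
    (p : (Fin m → ℝ) →ₗ[ℝ] (Fin n → ℝ)),
    p '' linearSystemSolutions C c D d = P

/-- The extension complexity of `P`: the smallest size of an extended formulation of `P`.
(Every polytope has an extended formulation, so the infimum is attained for polytopes.) -/
noncomputable def extensionComplexity {n : ℕ} (P : Set (Fin n → ℝ)) : ℕ :=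
  sInf {r : ℕ | HasExtendedFormulation P r}

/-- The independence polytope of a matroid on an `n`-element type: the convex hull of the
characteristic vectors of its independent sets. -/
noncomputable def matroidIndependencePolytope {n : ℕ} (M : Matroid (Fin n)) :
    Set (Fin n → ℝ) :=
  convexHull ℝ ((fun I : Set (Fin n) => I.indicator (1 : Fin n → ℝ)) '' {I | M.Indep I})

/-! The proof counts matroids against descriptions of small extended formulations. Take a code of at
least `n.choose (n / 2) / n` sets of size `k = n / 2`, no two of them one exchange apart
(`exists_large_constantWeight_code`). Each subfamily `F` is the set of non-bases of a sparse paving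
matroid (`exists_sparsePaving`), which gives doubly exponentially many matroids.

Suppose all have extension complexity at most `r`. By Farkas, the slacks `k - 1 - |S ∩ B|`, for `S ∈
F` and `B` a basis, factor as `⟨U S, Y B⟩` with nonnegative vectors in dimension `R = r + 1`. Among
the rows `(1, χ_S, U S)`, choose `d = n + R + 1` that generate all others with coefficients in `[-1,
1]`, and round their `U`-parts to a grid. The result determines `F`: a `k`-set `B ∉ F` has the
witness `Y B`, while for `B ∈ F` the row of `B` itself would require a nonnegative number close to
`-1` (`exists_code_of_slack_factorization`).

Comparing counts gives `|F₀| ≤ 8 n (n + 2 + r)²` for the code `F₀`, hence `4 ^ n ≤ 512 n⁵ (n + 2 +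
r)⁴`, so `r` has order at least `2 ^ (n / 2) / n ^ (5 / 4)`. The logarithm in the theorem is slack.
-/

/-! ### Farkas' lemma and nonnegative slack factorizations. -/

/-- **Farkas' lemma** for finitely many linear functionals. -/
theorem exists_nonneg_sum_smul_eq {V : Type*} [AddCommGroup V] [Module ℝ V] {r : ℕ}
    (f : Fin r → V →ₗ[ℝ] ℝ) (g : V →ₗ[ℝ] ℝ)
    (h : ∀ v, (∀ i, 0 ≤ f i v) → 0 ≤ g v) :
    ∃ c : Fin r → ℝ, (∀ i, 0 ≤ c i) ∧ ∀ v, g v = ∑ i, c i * f i v := by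
  induction r generalizing g with
  | zero =>
    refine ⟨0, by simp, fun v => ?_⟩
    have h1 := h v (fun i => i.elim0)
    have h2 := h (-v) (fun i => i.elim0)
    simp at h2 ⊢
    linarith
  | succ r ih =>
    by_cases h0 : ∀ v, (∀ i : Fin r, 0 ≤ f i.succ v) → 0 ≤ g v
    · obtain ⟨c, hc, hg⟩ := ih (fun i => f i.succ) g h0
      refine ⟨Fin.cons 0 c, fun i => Fin.cases (by simp) (by simpa using hc) i, fun v => ?_⟩
      simp [Fin.sum_univ_succ, hg]
    · push Not at h0
      obtain ⟨w, hw, hgw⟩ := h0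
      have hfw : f 0 w < 0 := by
        by_contra! h1
        exact absurd (h w (fun i => Fin.cases h1 hw i)) (not_le.2 hgw)
      obtain ⟨w, hw, hgw, hfw⟩ : ∃ w, (∀ i : Fin r, 0 ≤ f i.succ w) ∧ g w < 0 ∧ f 0 w = -1 := by
        refine ⟨(-(f 0 w))⁻¹ • w, fun i => ?_, ?_, ?_⟩
        · simp only [map_smul, smul_eq_mul]
          exact mul_nonneg (inv_nonneg.2 (by linarith)) (hw i)
        · simp only [map_smul, smul_eq_mul]
          exact mul_neg_of_pos_of_neg (inv_pos.2 (by linarith)) hgw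
        · simp only [map_smul, smul_eq_mul]
          rw [inv_neg, neg_mul, inv_mul_cancel₀ hfw.ne]
      -- As `f 0 w = -1`, the map `v ↦ v + f 0 v • w` projects onto the kernel of `f 0`; induction
      -- applies to the functionals composed with it.
      obtain ⟨c, hc, hg⟩ := ih (fun i => f i.succ + f i.succ w • f 0) (g + g w • f 0) (by
        intro v hv
        have := h (v + f 0 v • w) (fun i => Fin.cases (by simp [hfw]) (fun i => by
          have := hv i
          simp only [LinearMap.add_apply, LinearMap.smul_apply, smul_eq_mul] at this
          simp only [map_add, map_smul, smul_eq_mul]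
          linarith) i)
        simp only [map_add, map_smul, smul_eq_mul] at this
        simp only [LinearMap.add_apply, LinearMap.smul_apply, smul_eq_mul]
        linarith)
      have hpos : 0 ≤ ∑ i, c i * f i.succ w - g w := by
        have : 0 ≤ ∑ i, c i * f i.succ w := Finset.sum_nonneg fun i _ => mul_nonneg (hc i) (hw i)
        linarith
      refine ⟨Fin.cons (∑ i, c i * f i.succ w - g w) c,
        fun i => Fin.cases (by simpa using hpos) (by simpa using hc) i, fun v => ?_⟩
      have := hg v
      simp only [LinearMap.add_apply, LinearMap.smul_apply, smul_eq_mul, mul_add,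
        Finset.sum_add_distrib] at this
      simp only [Fin.sum_univ_succ, Fin.cons_zero, Fin.cons_succ, sub_mul, Finset.sum_mul]
      have e : ∑ i, c i * f i.succ w * f 0 v = ∑ i, c i * (f i.succ w * f 0 v) :=
        Finset.sum_congr rfl fun i _ => by ring
      linarith

/-- Every valid inequality on a polyhedron is a nonnegative combination of its defining
inequalities, on the solutions of the defining equations. -/
theorem exists_nonneg_slack_of_le {m r e : ℕ} (C : Matrix (Fin r) (Fin m) ℝ) (c : Fin r → ℝ)
    (D : Matrix (Fin e) (Fin m) ℝ) (d : Fin e → ℝ)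
    (hne : (linearSystemSolutions C c D d).Nonempty) (a : (Fin m → ℝ) →ₗ[ℝ] ℝ) (b : ℝ)
    (hab : ∀ z ∈ linearSystemSolutions C c D d, a z ≤ b) :
    ∃ u : Fin (r + 1) → ℝ, (∀ i, 0 ≤ u i) ∧ ∀ z, D.mulVec z = d →
      b - a z = u 0 + ∑ i : Fin r, u i.succ * (c i - C.mulVec z i) := by
  obtain ⟨z₀, hz₀, hDz₀⟩ := hne
  -- Homogenization: the cone over the polyhedron, with height `v.2`. The constraint `0 ≤ v.2` is
  -- the extra generator behind `r + 1`.
  let W : Submodule ℝ ((Fin m → ℝ) × ℝ) := LinearMap.ker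
    (D.mulVecLin.comp (LinearMap.fst ℝ _ ℝ) - (LinearMap.snd ℝ (Fin m → ℝ) ℝ).smulRight d)
  have hW : ∀ v : (Fin m → ℝ) × ℝ, v ∈ W ↔ D.mulVec v.1 = v.2 • d := by
    intro v
    simp [W, sub_eq_zero]
  let F : Fin (r + 1) → (Fin m → ℝ) × ℝ →ₗ[ℝ] ℝ := Fin.cons (LinearMap.snd ℝ _ ℝ) fun i =>
    c i • LinearMap.snd ℝ _ ℝ - (LinearMap.proj i).comp (C.mulVecLin.comp (LinearMap.fst ℝ _ ℝ))
  let G : (Fin m → ℝ) × ℝ →ₗ[ℝ] ℝ := b • LinearMap.snd ℝ _ ℝ - a.comp (LinearMap.fst ℝ _ ℝ)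
  have hF0 : ∀ v : (Fin m → ℝ) × ℝ, F 0 v = v.2 := fun v => by simp [F]
  have hFs : ∀ (v : (Fin m → ℝ) × ℝ) (i : Fin r), F i.succ v = c i * v.2 - C.mulVec v.1 i := fun v i => by
    simp [F]
  have hG : ∀ v : (Fin m → ℝ) × ℝ, G v = b * v.2 - a v.1 := fun v => by simp [G]
  obtain ⟨u, hu, h⟩ := exists_nonneg_sum_smul_eq (fun i => (F i).comp W.subtype)
    (G.comp W.subtype) (by
      rintro ⟨v, hv⟩ hFv
      rw [hW] at hv
      simp only [LinearMap.comp_apply, Submodule.subtype_apply] at hFv ⊢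
      -- At height zero `v` cannot be rescaled into the polyhedron, so it is first shifted by `ε`
      -- times a feasible point.
      have key : ∀ ε : ℝ, 0 < ε → 0 ≤ G v + ε * (b - a z₀) := by
        intro ε hε
        have ht : 0 ≤ v.2 := by simpa [hF0] using hFv 0
        have hpos : 0 < v.2 + ε := by linarith
        have hmem : (v.2 + ε)⁻¹ • (v.1 + ε • z₀) ∈ linearSystemSolutions C c D d := by
          constructor
          · intro i
            have h1 := hFv i.succ
            rw [hFs] at h1
            have h2 := hz₀ i
            rw [Matrix.mulVec_smul, Matrix.mulVec_add, Matrix.mulVec_smul]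
            simp only [Pi.smul_apply, Pi.add_apply, smul_eq_mul]
            rw [inv_mul_le_iff₀ hpos]
            nlinarith
          · rw [Matrix.mulVec_smul, Matrix.mulVec_add, Matrix.mulVec_smul, hv, hDz₀, ← add_smul,
              smul_smul, inv_mul_cancel₀ hpos.ne', one_smul]
        have h3 := hab _ hmem
        simp only [map_smul, map_add, smul_eq_mul] at h3
        rw [inv_mul_le_iff₀ hpos] at h3
        rw [hG]
        linarith
      by_contra! hneg
      rcases le_or_gt (b - a z₀) 0 with h0 | h0
      · have := key 1 one_pos
        linarith
      · have := key (-(G v) / (2 * (b - a z₀))) (by apply div_pos <;> linarith)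
        have e : -(G v) / (2 * (b - a z₀)) * (b - a z₀) = -(G v) / 2 := by field_simp
        linarith)
  refine ⟨u, hu, fun z hz => ?_⟩
  have := h ⟨(z, 1), by rw [hW]; simpa using hz⟩
  simp only [LinearMap.comp_apply, Submodule.subtype_apply, Fin.sum_univ_succ, hF0, hFs, hG,
    mul_one] at this
  exact this

/-- The slack matrix of a set with an extended formulation of size `r` factors through nonnegative
vectors with `r + 1` coordinates. -/
theorem HasExtendedFormulation.exists_slack_factorization {n r : ℕ} {P : Set (Fin n → ℝ)}
    (h : HasExtendedFormulation P r) (hne : P.Nonempty) {A T : Type*}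
    (a : A → (Fin n → ℝ) →ₗ[ℝ] ℝ) (b : A → ℝ) (hab : ∀ s, ∀ x ∈ P, a s x ≤ b s)
    (x : T → Fin n → ℝ) (hx : ∀ t, x t ∈ P) :
    ∃ (U : A → Fin (r + 1) → ℝ) (Y : T → Fin (r + 1) → ℝ), (∀ s i, 0 ≤ U s i) ∧
      (∀ t i, 0 ≤ Y t i) ∧ ∀ s t, b s - a s (x t) = ∑ i, U s i * Y t i := by
  obtain ⟨m, e, C, c, D, d, p, rfl⟩ := h
  choose U hU hUs using fun s => exists_nonneg_slack_of_le C c D d hne.of_image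
    ((a s).comp p) (b s) (fun z hz => hab s _ ⟨z, hz, rfl⟩)
  choose z hz hzx using hx
  refine ⟨U, fun t => Fin.cons 1 fun i => c i - C.mulVec (z t) i, hU,
    fun t i => Fin.cases (by simp) (fun i => by simpa using (hz t).1 i) i, fun s t => ?_⟩
  rw [← hzx, Fin.sum_univ_succ]
  simpa using hUs s (z t) (hz t).2

/-- Padding by zero coordinates. -/
theorem exists_factorization_of_le {A T : Type*} {M : A → T → ℝ} {r R : ℕ} (hrR : r ≤ R)
    (h : ∃ (U : A → Fin r → ℝ) (Y : T → Fin r → ℝ), (∀ s i, 0 ≤ U s i) ∧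
      (∀ t i, 0 ≤ Y t i) ∧ ∀ s t, M s t = ∑ i, U s i * Y t i) :
    ∃ (U : A → Fin R → ℝ) (Y : T → Fin R → ℝ), (∀ s i, 0 ≤ U s i) ∧
      (∀ t i, 0 ≤ Y t i) ∧ ∀ s t, M s t = ∑ i, U s i * Y t i := by
  obtain ⟨U, Y, hU, hY, hM⟩ := h
  obtain ⟨k, rfl⟩ := Nat.exists_eq_add_of_le hrR
  refine ⟨fun s => Fin.append (U s) 0, fun t => Fin.append (Y t) 0, fun s i => ?_, fun t i => ?_,
    fun s t => ?_⟩
  · exact Fin.addCases (fun i => by simpa using hU s i) (fun i => by simp) i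
  · exact Fin.addCases (fun i => by simpa using hY t i) (fun i => by simp) i
  · simp [Fin.sum_univ_add, hM]

/-- A nonnegative factorization can be rescaled so that the right factor has entries in `[0, 1]`
and the left factor is bounded by the entries of the product. -/
theorem exists_normalized_factorization {A T : Type*} [Finite T] {M : A → T → ℝ} {R : ℕ} {K : ℝ}
    (hK : ∀ s t, M s t ≤ K) (hK0 : 0 ≤ K)
    (h : ∃ (U : A → Fin R → ℝ) (Y : T → Fin R → ℝ), (∀ s i, 0 ≤ U s i) ∧
      (∀ t i, 0 ≤ Y t i) ∧ ∀ s t, M s t = ∑ i, U s i * Y t i) :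
    ∃ (U : A → Fin R → ℝ) (Y : T → Fin R → ℝ), (∀ s i, 0 ≤ U s i ∧ U s i ≤ K) ∧
      (∀ t i, 0 ≤ Y t i ∧ Y t i ≤ 1) ∧ ∀ s t, M s t = ∑ i, U s i * Y t i := by
  obtain ⟨U, Y, hU, hY, hM⟩ := h
  rcases isEmpty_or_nonempty T with hT | hT
  · exact ⟨0, fun t => isEmptyElim t, by simp [hK0], fun t => isEmptyElim t,
      fun s t => isEmptyElim t⟩
  -- Each coordinate is rescaled by its largest value over `T`, so each new left entry is a single
  -- term of an entry of `M`.
  choose t₀ ht₀ using fun i => Finite.exists_max fun t => Y t i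
  have hle : ∀ s t i, U s i * Y t i ≤ M s t := fun s t i => by
    rw [hM]
    exact Finset.single_le_sum (f := fun i => U s i * Y t i)
      (fun i _ => mul_nonneg (hU s i) (hY t i)) (Finset.mem_univ i)
  refine ⟨fun s i => U s i * Y (t₀ i) i, fun t i => Y t i / Y (t₀ i) i,
    fun s i => ⟨mul_nonneg (hU s i) (hY _ i), (hle s _ i).trans (hK s _)⟩,
    fun t i => ⟨div_nonneg (hY t i) (hY _ i), div_le_one_of_le₀ (ht₀ i t) (hY _ i)⟩,
    fun s t => ?_⟩
  rw [hM]
  refine Finset.sum_congr rfl fun i _ => ?_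
  rcases eq_or_ne (Y (t₀ i) i) 0 with h0 | h0
  · have : Y t i = 0 := le_antisymm ((ht₀ i t).trans h0.le) (hY t i)
    simp [this]
  · field_simp

/-! ### Barycentric spanners. -/

/-- A finite family in a space of dimension at most `d` has a subfamily of size `d` such that
all members are linear combinations of the subfamily with coefficients in `[-1, 1]`. -/
theorem exists_barycentric_spanner {A E : Type*} [Finite A] [Nonempty A] [AddCommGroup E]
    [Module ℝ E] [FiniteDimensional ℝ E] {d : ℕ} (hd : Module.finrank ℝ E ≤ d) (v : A → E) :
    ∃ s : Fin d → A, ∀ a, ∃ l : Fin d → ℝ, (∀ j, |l j| ≤ 1) ∧ v a = ∑ j, l j • v (s j) := by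
  classical
  obtain ⟨κ, b, -, hspan, hli⟩ := exists_linearIndependent' ℝ v
  have : Fintype κ := @Fintype.ofFinite _ hli.finite
  set W := Submodule.span ℝ (Set.range v)
  let w : A → W := fun a => ⟨v a, Submodule.subset_span ⟨a, rfl⟩⟩
  have hliW : LinearIndependent ℝ (w ∘ b) := LinearIndependent.of_comp W.subtype hli
  have hspanW : ⊤ ≤ Submodule.span ℝ (Set.range (w ∘ b)) := by
    rintro ⟨x, hx⟩ -
    have h2 : W.subtype ⟨x, hx⟩ ∈ (Submodule.span ℝ (Set.range (w ∘ b))).map W.subtype := by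
      rw [Submodule.map_span, ← Set.range_comp]
      exact hspan.ge hx
    obtain ⟨y, hy, hyx⟩ := h2
    rwa [← W.injective_subtype hyx]
  let e : Module.Basis κ ℝ W := Module.Basis.mk hliW hspanW
  -- A subfamily of maximal absolute determinant works: by Cramer's rule each coordinate is a ratio
  -- of two determinants, with the maximal one below.
  obtain ⟨t, ht⟩ := Finite.exists_max fun t : κ → A => |e.det (w ∘ t)|
  have hpos : 0 < |e.det (w ∘ t)| := by
    refine lt_of_lt_of_le ?_ (ht b)
    have : (w ∘ b) = e := by simp [e]
    rw [this, e.det_self]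
    simp
  obtain ⟨hli', hspan'⟩ := e.is_basis_iff_det.2 (isUnit_iff_ne_zero.2 (abs_pos.1 hpos))
  let f : Module.Basis κ ℝ W := Module.Basis.mk hli' hspan'.ge
  have hcard : Fintype.card κ ≤ d := by
    rw [← Module.finrank_eq_card_basis e]
    exact (Submodule.finrank_le W).trans hd
  have hf : ∀ a, v a = ∑ i, f.coord i (w a) • v (t i) := fun a => by
    have := congrArg W.subtype (f.sum_repr (w a))
    rw [map_sum] at this
    simpa [f, w] using this.symm
  have hcoord : ∀ a i, |f.coord i (w a)| ≤ 1 := fun a i => by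
    have h1 : f.det (w ∘ t) = 1 := by
      have : w ∘ t = f := by simp [f]
      rw [this, f.det_self]
    have h2 := e.det_smul_mk_coord_eq_det_update hli' hspan'.ge i
    have h3 := congrArg (fun g => g (w a)) h2
    simp only [LinearMap.smul_apply, smul_eq_mul] at h3
    have h4 := ht (Function.update t i a)
    rw [Function.comp_update] at h4
    change e.det (w ∘ t) * f.coord i (w a) = e.det (Function.update (w ∘ t) i (w a)) at h3
    rw [← h3, abs_mul] at h4
    exact (mul_le_iff_le_one_right hpos).1 h4
  obtain ⟨k, rfl⟩ := Nat.exists_eq_add_of_le hcard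
  let q := Fintype.equivFin κ
  refine ⟨Fin.append (t ∘ q.symm) fun _ => Classical.arbitrary A, fun a =>
    ⟨Fin.append (fun i => f.coord (q.symm i) (w a)) 0, fun j => ?_, ?_⟩⟩
  · exact Fin.addCases (fun i => by simpa using hcoord a _) (fun i => by simp) j
  · rw [hf a, Fin.sum_univ_add, ← q.symm.sum_comp]
    simp

/-! ### Sparse paving matroids and constant weight codes. -/

/-- Sparse paving matroids: a family of `k`-sets, any two of which differ by more than one
exchange, is the family of non-bases of a matroid of rank `k`. -/
theorem exists_sparsePaving {n k : ℕ} (hk : 1 ≤ k) (hkn : k < n) (F : Finset (Finset (Fin n)))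
    (hF : ∀ S ∈ F, S.card = k) (hF2 : ∀ S ∈ F, ∀ T ∈ F, S ≠ T → (S ∩ T).card + 2 ≤ k) :
    ∃ M : Matroid (Fin n), M.E = Set.univ ∧
      ∀ B : Finset (Fin n), M.IsBase B ↔ B.card = k ∧ B ∉ F := by
  -- Two exchanges out of the same `B.erase e` share `k - 1` elements, so at most one of them is in
  -- `F`.
  have swap : ∀ (B : Finset (Fin n)) (e f g : Fin n), e ∈ B → f ∉ B → g ∉ B → f ≠ g →
      insert f (B.erase e) ∈ F → insert g (B.erase e) ∉ F := by
    intro B e f g he hf hg hfg h1 h2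
    have hne : insert f (B.erase e) ≠ insert g (B.erase e) := fun h => by
      have : f ∈ insert g (B.erase e) := h ▸ Finset.mem_insert_self _ _
      simp [hfg, hf] at this
    have h3 := hF2 _ h1 _ h2 hne
    have h4 := hF _ h1
    rw [Finset.card_insert_of_notMem (by simp [hf])] at h4
    have h5 : (B.erase e).card ≤ (insert f (B.erase e) ∩ insert g (B.erase e)).card :=
      Finset.card_le_card (Finset.subset_inter (Finset.subset_insert _ _)
        (Finset.subset_insert _ _))
    omega
  have hex : ∃ B : Finset (Fin n), B.card = k ∧ B ∉ F := by
    by_contra! hall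
    obtain ⟨B, -, hB⟩ := Finset.exists_subset_card_eq
      (s := (Finset.univ : Finset (Fin n))) (n := k + 1) (by simpa using hkn)
    obtain ⟨f, hf⟩ := Finset.card_pos.1 (by omega : 0 < B.card)
    obtain ⟨g, hg⟩ := Finset.card_pos.1
      (by rw [Finset.card_erase_of_mem hf]; omega : 0 < (B.erase f).card)
    have hfc : (B.erase f).card = k := by rw [Finset.card_erase_of_mem hf]; omega
    have hgB := Finset.mem_of_mem_erase hg
    have hgc : (B.erase g).card = k := by rw [Finset.card_erase_of_mem hgB]; omega
    have hne : B.erase f ≠ B.erase g := fun h => by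
      rw [h] at hg
      simp at hg
    have h1 := hF2 _ (hall _ hfc) _ (hall _ hgc) hne
    have h2 := Finset.card_union_add_card_inter (B.erase f) (B.erase g)
    have h3 : (B.erase f ∪ B.erase g).card ≤ B.card :=
      Finset.card_le_card (Finset.union_subset (Finset.erase_subset _ _) (Finset.erase_subset _ _))
    omega
  let IsB : Set (Fin n) → Prop := fun X => ∃ B : Finset (Fin n), (B : Set (Fin n)) = X ∧
    B.card = k ∧ B ∉ F
  refine ⟨Matroid.ofIsBaseOfFinite Set.finite_univ IsB ?_ ?_ fun _ _ => Set.subset_univ _, rfl,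
    fun B => ?_⟩
  · obtain ⟨B, hB⟩ := hex
    exact ⟨B, B, rfl, hB⟩
  · rintro _ _ ⟨B, rfl, hBk, hBF⟩ ⟨B', rfl, hBk', hBF'⟩ e ⟨he, he'⟩
    have he : e ∈ B := he
    have he' : e ∉ B' := he'
    have hcard : (B \ B').card = (B' \ B).card := Finset.card_sdiff_comm (hBk.trans hBk'.symm)
    have hfin : ∀ f, f ∉ B → insert f (B.erase e) ∉ F →
        IsB (insert f ((B : Set (Fin n)) \ {e})) := fun f hf hfF =>
      ⟨insert f (B.erase e), by simp, by
        rw [Finset.card_insert_of_notMem (by simp [hf]), Finset.card_erase_of_mem he]; omega, hfF⟩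
    -- With two candidates to insert, `swap` makes one succeed; with only one, the exchange produces
    -- `B'` itself.
    rcases lt_or_ge 1 (B' \ B).card with h1 | h1
    · obtain ⟨f, hf, g, hg, hfg⟩ := Finset.one_lt_card.1 h1
      rw [Finset.mem_sdiff] at hf hg
      by_cases hfF : insert f (B.erase e) ∈ F
      · exact ⟨g, by simpa using hg, hfin g hg.2 (swap B e f g he hf.2 hg.2 hfg hfF)⟩
      · exact ⟨f, by simpa using hf, hfin f hf.2 hfF⟩
    · have hmem : e ∈ B \ B' := Finset.mem_sdiff.2 ⟨he, he'⟩
      have h2 : (B' \ B).card = 1 := le_antisymm h1 (hcard ▸ Finset.card_pos.2 ⟨e, hmem⟩)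
      obtain ⟨f, hf⟩ := Finset.card_eq_one.1 h2
      have hfm : f ∈ B' \ B := hf ▸ Finset.mem_singleton_self f
      rw [Finset.mem_sdiff] at hfm
      refine ⟨f, by simpa using hfm, hfin f hfm.2 ?_⟩
      have : insert f (B.erase e) = B' := by
        symm
        apply Finset.eq_of_subset_of_card_le
        · intro x hx
          by_cases hxB : x ∈ B
          · refine Finset.mem_insert_of_mem (Finset.mem_erase.2 ⟨?_, hxB⟩)
            rintro rfl
            exact he' hx
          · have : x ∈ B' \ B := Finset.mem_sdiff.2 ⟨hx, hxB⟩
            rw [hf, Finset.mem_singleton] at this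
            simp [this]
        · rw [Finset.card_insert_of_notMem (by simp [hfm.2]), Finset.card_erase_of_mem he]
          omega
      rwa [this]
  · change IsB B ↔ _
    constructor
    · rintro ⟨B', h, hB'⟩
      rw [Finset.coe_injective h] at hB'
      exact hB'
    · exact fun h => ⟨B, rfl, h⟩

/-- The Graham–Sloane code: many `k`-sets with pairwise distance at least four. -/
theorem exists_large_constantWeight_code (n k : ℕ) (hn : 1 ≤ n) :
    ∃ F : Finset (Finset (Fin n)), (∀ S ∈ F, S.card = k) ∧
      (∀ S ∈ F, ∀ T ∈ F, S ≠ T → (S ∩ T).card + 2 ≤ k) ∧ n.choose k ≤ n * F.card := by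
  have : NeZero n := ⟨by omega⟩
  -- The most frequent value of the element sum modulo `n`. Two `k`-sets one exchange apart have
  -- different sums.
  obtain ⟨c, -, hc⟩ := Finset.exists_max_image (Finset.univ : Finset (Fin n)) (fun c =>
    ((Finset.powersetCard k (Finset.univ : Finset (Fin n))).filter
      fun S => ∑ i ∈ S, i = c).card) ⟨0, by simp⟩
  refine ⟨(Finset.powersetCard k (Finset.univ : Finset (Fin n))).filter
    fun S => ∑ i ∈ S, i = c, fun S hS => ?_, fun S hS T hT hST => ?_, ?_⟩
  · simp only [Finset.mem_filter, Finset.mem_powersetCard] at hS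
    exact hS.1.2
  · simp only [Finset.mem_filter, Finset.mem_powersetCard, Finset.subset_univ, true_and] at hS hT
    by_contra! hlt
    have h1 := Finset.card_sdiff_add_card_inter S T
    have h2 := Finset.card_sdiff_add_card_inter T S
    rw [Finset.inter_comm] at h2
    have hpos : 0 < (S \ T).card := by
      rw [Finset.card_pos, Finset.nonempty_iff_ne_empty, Ne, Finset.sdiff_eq_empty_iff_subset]
      exact fun h => hST (Finset.eq_of_subset_of_card_le h (by omega))
    obtain ⟨a, ha⟩ := Finset.card_eq_one.1 (by omega : (S \ T).card = 1)
    obtain ⟨b, hb⟩ := Finset.card_eq_one.1 (by omega : (T \ S).card = 1)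
    have h3 := Finset.sum_inter_add_sum_sdiff S T (fun i : Fin n => i)
    have h4 := Finset.sum_inter_add_sum_sdiff T S (fun i : Fin n => i)
    rw [ha, hS.2, Finset.sum_singleton] at h3
    rw [hb, hT.2, Finset.sum_singleton, Finset.inter_comm] at h4
    have hab : a = b := add_left_cancel (h3.trans h4.symm)
    have h5 : a ∈ S \ T := ha ▸ Finset.mem_singleton_self a
    have h6 : b ∈ T \ S := hb ▸ Finset.mem_singleton_self b
    rw [Finset.mem_sdiff] at h5 h6
    exact h5.2 (hab ▸ h6.1)
  · have h1 := Finset.card_eq_sum_card_fiberwise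
      (s := Finset.powersetCard k (Finset.univ : Finset (Fin n)))
      (t := (Finset.univ : Finset (Fin n))) (f := fun S => ∑ i ∈ S, i) (fun _ _ => by simp)
    rw [Finset.card_powersetCard, Finset.card_univ, Fintype.card_fin] at h1
    rw [h1]
    refine (Finset.sum_le_card_nsmul _ _ _ fun x _ => hc x (Finset.mem_univ x)).trans ?_
    simp

/-! ### Lower bounds for middle binomial coefficients. -/

theorem sixteen_pow_le_mul_centralBinom_sq (m : ℕ) (hm : 1 ≤ m) :
    16 ^ m ≤ 4 * m * m.centralBinom ^ 2 := by
  induction m, hm using Nat.le_induction with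
  | base => simp [Nat.centralBinom]
  | succ m hm ih =>
    have h := Nat.succ_mul_centralBinom_succ m
    have h2 : (m + 1) * (4 * (m + 1) * (m + 1).centralBinom ^ 2) =
        16 * (2 * m + 1) ^ 2 * m.centralBinom ^ 2 := by
      calc _ = 4 * ((m + 1) * (m + 1).centralBinom) ^ 2 := by ring
        _ = _ := by rw [h]; ring
    refine Nat.le_of_mul_le_mul_left (c := m + 1) ?_ (by omega)
    rw [h2, pow_succ]
    have h3 : 4 * m * (m + 1) ≤ (2 * m + 1) ^ 2 := by nlinarith
    calc (m + 1) * (16 ^ m * 16) ≤ (m + 1) * (4 * m * m.centralBinom ^ 2 * 16) := by gcongr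
      _ = 16 * (4 * m * (m + 1)) * m.centralBinom ^ 2 := by ring
      _ ≤ _ := by gcongr

theorem four_pow_le_mul_choose_half_sq (n : ℕ) (hn : 2 ≤ n) :
    4 ^ n ≤ 8 * n * n.choose (n / 2) ^ 2 := by
  rcases Nat.even_or_odd' n with ⟨m, rfl | rfl⟩
  · have := sixteen_pow_le_mul_centralBinom_sq m (by omega)
    rw [Nat.mul_div_cancel_left m two_pos, pow_mul, ← Nat.centralBinom_eq_two_mul_choose]
    norm_num
    nlinarith
  · have := sixteen_pow_le_mul_centralBinom_sq m (by omega)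
    have h1 : (2 * m + 1) / 2 = m := by omega
    have h2 : m.centralBinom ≤ (2 * m + 1).choose m := by
      rw [Nat.centralBinom_eq_two_mul_choose]
      exact Nat.choose_le_choose m (by omega)
    rw [h1, pow_succ, pow_mul]
    calc _ ≤ 4 * m * m.centralBinom ^ 2 * 4 := by norm_num; omega
      _ ≤ 8 * (2 * m + 1) * m.centralBinom ^ 2 := by nlinarith
      _ ≤ _ := by gcongr

/-! ### Independence polytopes and their slacks. -/

/-- The characteristic vectors of independent sets lie in the independence polytope. -/
theorem indicator_mem_matroidIndependencePolytope {n : ℕ} {M : Matroid (Fin n)} {I : Set (Fin n)}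
    (hI : M.Indep I) : I.indicator (1 : Fin n → ℝ) ∈ matroidIndependencePolytope M :=
  subset_convexHull ℝ _ ⟨I, hI, rfl⟩

theorem le_of_mem_matroidIndependencePolytope {n : ℕ} {M : Matroid (Fin n)}
    {a : (Fin n → ℝ) →ₗ[ℝ] ℝ} {b : ℝ} (h : ∀ I, M.Indep I → a (I.indicator 1) ≤ b)
    {x : Fin n → ℝ} (hx : x ∈ matroidIndependencePolytope M) : a x ≤ b := by
  refine convexHull_min (t := {x | a x ≤ b}) ?_ (convex_halfSpace_le a.isLinear b) hx
  rintro _ ⟨I, hI, rfl⟩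
  exact h I hI

theorem matroidIndependencePolytope_nonempty {n : ℕ} (M : Matroid (Fin n)) :
    (matroidIndependencePolytope M).Nonempty :=
  ⟨_, indicator_mem_matroidIndependencePolytope M.empty_indep⟩

/-- The linear functional `x ↦ ∑ i ∈ S, x i`. -/
def sumOver {n : ℕ} (S : Finset (Fin n)) : (Fin n → ℝ) →ₗ[ℝ] ℝ := ∑ i ∈ S, LinearMap.proj i

theorem sumOver_apply {n : ℕ} (S : Finset (Fin n)) (x : Fin n → ℝ) :
    sumOver S x = ∑ i ∈ S, x i := by
  simp [sumOver]

theorem sumOver_indicator {n : ℕ} (S T : Finset (Fin n)) :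
    sumOver S ((T : Set (Fin n)).indicator 1) = ((S ∩ T).card : ℝ) := by
  simp [sumOver_apply, Set.indicator_apply]

/-- A polytope has an extended formulation. -/
theorem exists_hasExtendedFormulation_convexHull {n : ℕ} {s : Set (Fin n → ℝ)} (hs : s.Finite) :
    ∃ r, HasExtendedFormulation (convexHull ℝ s) r := by
  let := hs.fintype
  let q := Fintype.equivFin s
  let L : (Fin (Fintype.card s) → ℝ) ≃ₗ[ℝ] (s → ℝ) := LinearEquiv.funCongrLeft ℝ ℝ q
  refine ⟨Fintype.card s, Fintype.card s, 1, -1, 0, fun _ _ => 1, fun _ => 1,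
    (∑ x : s, (LinearMap.proj (R := ℝ) (φ := fun _ : s => ℝ) x).smulRight x.1).comp L.toLinearMap,
    ?_⟩
  rw [hs.convexHull_eq_image, LinearMap.coe_comp, Set.image_comp]
  refine congrArg _ (Set.ext fun w => ?_)
  constructor
  · rintro ⟨z, ⟨h1, h2⟩, rfl⟩
    refine ⟨fun x => ?_, ?_⟩
    · have := h1 (q x)
      simpa [Matrix.neg_mulVec, L, LinearEquiv.funCongrLeft_apply, LinearMap.funLeft_apply]
        using this
    · have := congrFun h2 0
      simp only [Matrix.mulVec, dotProduct, one_mul] at this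
      rw [← this, ← q.sum_comp]
      rfl
  · rintro ⟨h1, h2⟩
    refine ⟨L.symm w, ⟨fun i => ?_, ?_⟩, by simp⟩
    · have : 0 ≤ L.symm w i := h1 (q.symm i)
      simpa [Matrix.neg_mulVec] using this
    · ext
      simp only [Matrix.mulVec, dotProduct, one_mul]
      rw [← h2, ← q.symm.sum_comp]
      rfl

/-- Without nonemptiness of the set of sizes, `sInf` in `ℕ` would return the default value `0`. -/
theorem hasExtendedFormulation_extensionComplexity {n : ℕ} (M : Matroid (Fin n)) :
    HasExtendedFormulation (matroidIndependencePolytope M)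
      (extensionComplexity (matroidIndependencePolytope M)) :=
  Nat.sInf_mem (s := {r | HasExtendedFormulation (matroidIndependencePolytope M) r})
    (exists_hasExtendedFormulation_convexHull ((Set.toFinite _).image _))

/-- A nonnegative factorization of the slacks between the non-bases and the bases of a sparse
paving matroid, from an extended formulation of its independence polytope. -/
theorem exists_sparsePaving_slack_factorization {n k r R : ℕ} (hkn : k ≤ n)
    {F : Finset (Finset (Fin n))} (hF : ∀ S ∈ F, S.card = k) {M : Matroid (Fin n)}
    (hM : ∀ B : Finset (Fin n), M.IsBase B ↔ B.card = k ∧ B ∉ F)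
    (h : HasExtendedFormulation (matroidIndependencePolytope M) r) (hrR : r + 1 ≤ R) :
    ∃ (U : F → Fin R → ℝ) (Y : {B : Finset (Fin n) // B.card = k ∧ B ∉ F} → Fin R → ℝ),
      (∀ S i, 0 ≤ U S i ∧ U S i ≤ n) ∧ (∀ B i, 0 ≤ Y B i ∧ Y B i ≤ 1) ∧
      ∀ (S : F) B, ((k : ℝ) - 1) - ((S.1 ∩ B.1).card : ℝ) = ∑ i, U S i * Y B i := by
  refine exists_normalized_factorization (fun S B => ?_) (Nat.cast_nonneg n)
    (exists_factorization_of_le hrR ?_)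
  · have h1 : (k : ℝ) ≤ n := by exact_mod_cast hkn
    have h2 : (0 : ℝ) ≤ ((S.1 ∩ B.1).card : ℝ) := by positivity
    linarith
  · have hvalid : ∀ S : F, ∀ x ∈ matroidIndependencePolytope M, sumOver S.1 x ≤ (k : ℝ) - 1 := by
      rintro ⟨S, hS⟩ x hx
      refine le_of_mem_matroidIndependencePolytope (fun I hI => ?_) hx
      obtain ⟨B, hB, hIB⟩ := hI.exists_isBase_superset
      classical
      have eB : (B.toFinset : Set (Fin n)) = B := by simp
      have eI : (I.toFinset : Set (Fin n)) = I := by simp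
      rw [← eB, hM] at hB
      rw [← eI, sumOver_indicator]
      have hsub : I.toFinset ⊆ B.toFinset := Set.toFinset_subset_toFinset.2 hIB
      have hlt : (S ∩ I.toFinset).card < k := by
        rw [← hF S hS]
        refine Finset.card_lt_card (Finset.ssubset_iff_subset_ne.2
          ⟨Finset.inter_subset_left, fun he => ?_⟩)
        have h1 : S ⊆ B.toFinset := (Finset.inter_eq_left.1 he).trans hsub
        have h2 : S = B.toFinset :=
          Finset.eq_of_subset_of_card_le h1 (by rw [hB.1, hF S hS])
        exact hB.2 (h2 ▸ hS)
      have : ((S ∩ I.toFinset).card : ℝ) + 1 ≤ k := by exact_mod_cast hlt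
      linarith
    obtain ⟨U, Y, hU, hY, hUY⟩ := h.exists_slack_factorization
      (matroidIndependencePolytope_nonempty M) (fun S : F => sumOver S.1) (fun _ => (k : ℝ) - 1)
      hvalid (fun B : {B : Finset (Fin n) // B.card = k ∧ B ∉ F} =>
        (B.1 : Set (Fin n)).indicator 1)
      (fun B => indicator_mem_matroidIndependencePolytope ((hM B.1).2 B.2).indep)
    exact ⟨U, Y, hU, hY, fun S B => by rw [← hUY, sumOver_indicator]⟩

/-! ### Encoding matroids and counting. -/

/-- The sets recovered from rounded rows of a slack factorization. -/
def DecodesTo {n d R G : ℕ} (k : ℕ) (c : Fin d → Finset (Fin n) × (Fin R → Fin G))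
    (B : Finset (Fin n)) : Prop :=
  ∃ y : Fin R → ℝ, (∀ i, 0 ≤ y i ∧ y i ≤ 1) ∧ ∀ j,
    |((k : ℝ) - 1) - (((c j).1 ∩ B).card : ℝ) - ∑ i, ((c j).2 i : ℝ) / (4 * d * R) * y i| ≤
      1 / (4 * d)

/-- A slack factorization can be encoded by few rounded rows. -/
theorem exists_code_of_slack_factorization {n k R d : ℕ} (hd : d = n + R + 1) (hR : 1 ≤ R)
    {F : Finset (Finset (Fin n))} (hne : F.Nonempty)
    (h : ∃ (U : F → Fin R → ℝ) (Y : {B : Finset (Fin n) // B.card = k ∧ B ∉ F} → Fin R → ℝ),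
      (∀ S i, 0 ≤ U S i ∧ U S i ≤ n) ∧ (∀ B i, 0 ≤ Y B i ∧ Y B i ≤ 1) ∧
      ∀ (S : F) B, ((k : ℝ) - 1) - ((S.1 ∩ B.1).card : ℝ) = ∑ i, U S i * Y B i) :
    ∃ c : Fin d → Finset (Fin n) × (Fin R → Fin (4 * n * d * R + 1)),
      ∀ B : Finset (Fin n), B.card = k → (DecodesTo k c B ↔ B ∉ F) := by
  obtain ⟨U, Y, hU, hY, hUY⟩ := h
  have := hne.to_subtype
  have hd0 : (0 : ℝ) < d := by rw [hd]; positivity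
  have hR0 : (0 : ℝ) < R := by exact_mod_cast hR
  have hD : (0 : ℝ) < 4 * d * R := by positivity
  obtain ⟨s, hs⟩ := exists_barycentric_spanner (d := d)
    (E := ℝ × (Fin n → ℝ) × (Fin R → ℝ)) (by simp; omega)
    (fun S : F => ((1 : ℝ), (S.1 : Set (Fin n)).indicator (1 : Fin n → ℝ), U S))
  -- Grid width `1 / (4 d R)`: the `R` rounding errors of a row add up to at most `1 / (4 d)`.
  let g : F → Fin R → Fin (4 * n * d * R + 1) := fun S i => ⟨⌊U S i * (4 * d * R)⌋₊, by
    rw [Nat.lt_succ_iff]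
    refine Nat.floor_le_of_le ?_
    push_cast
    nlinarith [(hU S i).2]⟩
  have hg : ∀ S i, |U S i - (g S i : ℝ) / (4 * d * R)| ≤ 1 / (4 * d * R) := fun S i => by
    have h1 := Nat.floor_le (mul_nonneg (hU S i).1 hD.le)
    have h2 := Nat.lt_floor_add_one (U S i * (4 * d * R))
    have e : U S i = U S i * (4 * d * R) / (4 * d * R) := by field_simp
    rw [e, ← sub_div, abs_div, abs_of_pos hD]
    refine div_le_div_of_nonneg_right ?_ hD.le
    rw [abs_le]
    constructor <;> simp only [g] <;> linarith
  have herr : ∀ S (y : Fin R → ℝ), (∀ i, 0 ≤ y i ∧ y i ≤ 1) →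
      |∑ i, U S i * y i - ∑ i, (g S i : ℝ) / (4 * d * R) * y i| ≤ 1 / (4 * d) := fun S y hy => by
    rw [← Finset.sum_sub_distrib]
    calc _ ≤ ∑ i, |U S i * y i - (g S i : ℝ) / (4 * d * R) * y i| := Finset.abs_sum_le_sum_abs _ _
      _ ≤ ∑ _i : Fin R, 1 / (4 * (d : ℝ) * R) := by
        refine Finset.sum_le_sum fun i _ => ?_
        rw [← sub_mul, abs_mul, abs_of_nonneg (hy i).1]
        calc _ ≤ 1 / (4 * (d : ℝ) * R) * 1 := mul_le_mul (hg S i) (hy i).2 (hy i).1 (by positivity)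
          _ = _ := mul_one _
      _ = _ := by
        simp
        field_simp
  refine ⟨fun j => ((s j).1, g (s j)), fun B hB => ⟨?_, fun hBF => ?_⟩⟩
  · rintro ⟨y, hy, hyc⟩ hBF
    obtain ⟨l, hl, hlB⟩ := hs ⟨B, hBF⟩
    let φ : ℝ × (Fin n → ℝ) × (Fin R → ℝ) →ₗ[ℝ] ℝ :=
      ((k : ℝ) - 1) • LinearMap.fst ℝ _ _
      - (sumOver B).comp ((LinearMap.fst ℝ _ _).comp (LinearMap.snd ℝ _ _))
      - (∑ i, y i • (LinearMap.proj i : (Fin R → ℝ) →ₗ[ℝ] ℝ)).comp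
          ((LinearMap.snd ℝ _ _).comp (LinearMap.snd ℝ _ _))
    have hφ : ∀ S : F, φ (1, (S.1 : Set (Fin n)).indicator 1, U S) =
        ((k : ℝ) - 1) - ((S.1 ∩ B).card : ℝ) - ∑ i, U S i * y i := fun S => by
      rw [Finset.inter_comm]
      simp [φ, sumOver_indicator, mul_comm]
    have h1 := congrArg φ hlB
    rw [hφ, map_sum, Finset.inter_self, hB] at h1
    -- Tolerance plus rounding is at most `1 / (2 d)` for each of the `d` rows, hence `1 / 2` in
    -- total, whereas the row of `B` gives at most `-1`.
    have h2 : |∑ j, φ (l j • (1, ((s j).1 : Set (Fin n)).indicator 1, U (s j)))| ≤ 1 / 2 := by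
      calc _ ≤ ∑ j, |φ (l j • (1, ((s j).1 : Set (Fin n)).indicator 1, U (s j)))| :=
            Finset.abs_sum_le_sum_abs _ _
        _ ≤ ∑ _j : Fin d, 1 / (2 * (d : ℝ)) := by
          refine Finset.sum_le_sum fun j _ => ?_
          rw [map_smul, hφ, smul_eq_mul, abs_mul]
          have e : 1 / (2 * (d : ℝ)) = 1 / (4 * d) + 1 / (4 * d) := by field_simp; norm_num
          have h3 : |((k : ℝ) - 1) - (((s j).1 ∩ B).card : ℝ) - ∑ i, U (s j) i * y i| ≤
              1 / (2 * (d : ℝ)) := by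
            rw [e]
            have h4 := abs_le.1 (hyc j)
            have h5 := abs_le.1 (herr (s j) y hy)
            rw [abs_le]
            constructor <;> linarith [h4.1, h4.2, h5.1, h5.2]
          calc _ ≤ 1 * (1 / (2 * (d : ℝ))) := mul_le_mul (hl j) h3 (abs_nonneg _) one_pos.le
            _ = _ := one_mul _
        _ = _ := by
          simp
          field_simp
    have h6 : 0 ≤ ∑ i, U ⟨B, hBF⟩ i * y i :=
      Finset.sum_nonneg fun i _ => mul_nonneg (hU _ i).1 (hy i).1
    rw [← h1] at h2
    have := (abs_le.1 h2).1
    linarith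
  · refine ⟨Y ⟨B, hB, hBF⟩, hY _, fun j => ?_⟩
    rw [hUY (s j) ⟨B, hB, hBF⟩]
    exact herr (s j) _ (hY _)

/-- Counting: if every nonempty subfamily of a code gives a sparse paving matroid of extension
complexity at most `r`, then the code is small. -/
theorem two_pow_card_le_of_extensionComplexity_le {n k r : ℕ} (hkn : k ≤ n)
    {F₀ : Finset (Finset (Fin n))} (hF₀ : ∀ S ∈ F₀, S.card = k)
    (h : ∀ F ⊆ F₀, ∃ M : Matroid (Fin n),
      (∀ B : Finset (Fin n), M.IsBase B ↔ B.card = k ∧ B ∉ F) ∧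
      extensionComplexity (matroidIndependencePolytope M) ≤ r) :
    2 ^ F₀.card ≤
      (2 ^ n * (4 * n * (n + (r + 1) + 1) * (r + 1) + 1) ^ (r + 1)) ^ (n + (r + 1) + 1) + 1 := by
  classical
  have hcode : ∀ F ⊆ F₀, F.Nonempty → ∃ c : Fin (n + (r + 1) + 1) → Finset (Fin n) ×
      (Fin (r + 1) → Fin (4 * n * (n + (r + 1) + 1) * (r + 1) + 1)),
      ∀ B : Finset (Fin n), B.card = k → (DecodesTo k c B ↔ B ∉ F) := by
    intro F hF hne
    obtain ⟨M, hM, hr⟩ := h F hF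
    exact exists_code_of_slack_factorization rfl (by omega) hne
      (exists_sparsePaving_slack_factorization hkn (fun S hS => hF₀ S (hF hS)) hM
        (hasExtendedFormulation_extensionComplexity M) (by omega))
  choose! c hc using hcode
  -- The empty family has no rows to choose from, hence no code; it accounts for the `+ 1` in the
  -- bound.
  have hinj : Set.InjOn c (F₀.powerset.erase ∅ : Finset (Finset (Finset (Fin n)))) := by
    intro F hF F' hF' hFF'
    simp only [Finset.coe_erase, Set.mem_sdiff, Finset.mem_coe, Finset.mem_powerset,
      Set.mem_singleton_iff] at hF hF'
    have key := hc F hF.1 (Finset.nonempty_iff_ne_empty.2 hF.2)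
    have key' := hc F' hF'.1 (Finset.nonempty_iff_ne_empty.2 hF'.2)
    rw [← hFF'] at key'
    ext B
    by_cases hB : B.card = k
    · exact not_iff_not.1 ((key B hB).symm.trans (key' B hB))
    · exact ⟨fun hm => absurd (hF₀ B (hF.1 hm)) hB, fun hm => absurd (hF₀ B (hF'.1 hm)) hB⟩
  have h1 := Finset.card_le_card_of_injOn c (t := Finset.univ) (fun _ _ => Finset.mem_univ _) hinj
  rw [Finset.card_erase_of_mem (Finset.empty_mem_powerset F₀), Finset.card_powerset,
    Finset.card_univ] at h1
  simp only [Fintype.card_fun, Fintype.card_prod, Fintype.card_finset, Fintype.card_fin] at h1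
  omega

/-- The independence polytope of a free matroid on a nonempty ground set has positive extension
complexity. -/
theorem one_le_extensionComplexity_freeOn {n : ℕ} (hn : 1 ≤ n) :
    1 ≤ extensionComplexity
      (matroidIndependencePolytope (Matroid.freeOn (Set.univ : Set (Fin n)))) := by
  rw [Nat.one_le_iff_ne_zero]
  intro h0
  have h := hasExtendedFormulation_extensionComplexity (Matroid.freeOn (Set.univ : Set (Fin n)))
  rw [h0] at h
  obtain ⟨m, e, C, c, D, d, p, hP⟩ := h
  have hmem : ∀ I : Set (Fin n), I.indicator (1 : Fin n → ℝ) ∈ p '' linearSystemSolutions C c D d :=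
    fun I => hP ▸ indicator_mem_matroidIndependencePolytope (by simp)
  obtain ⟨z₀, ⟨-, hz₀⟩, hp₀⟩ := hmem ∅
  obtain ⟨z₁, ⟨-, hz₁⟩, hp₁⟩ := hmem Set.univ
  -- With no inequalities the polyhedron is an affine subspace, so it contains the reflection of
  -- `z₀` in `z₁`, whose image has all coordinates `2`.
  have hz : (2 : ℝ) • z₁ - z₀ ∈ linearSystemSolutions C c D d :=
    ⟨fun i => i.elim0, by rw [Matrix.mulVec_sub, Matrix.mulVec_smul, hz₀, hz₁]; module⟩
  have hx : p ((2 : ℝ) • z₁ - z₀) ∈ matroidIndependencePolytope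
      (Matroid.freeOn (Set.univ : Set (Fin n))) := hP ▸ ⟨_, hz, rfl⟩
  have := le_of_mem_matroidIndependencePolytope (a := LinearMap.proj (⟨0, hn⟩ : Fin n)) (b := 1)
    (fun I _ => by
      simp only [LinearMap.proj_apply]
      exact Set.indicator_apply_le' (fun _ => le_rfl) fun _ => zero_le_one) hx
  rw [map_sub, map_smul, hp₀, hp₁] at this
  norm_num at this

/-- The counting bound in logarithmic form. -/
theorem card_le_of_two_pow_card_le {n r N : ℕ} (hn : 1 ≤ n) (hr : r + 1 ≤ 2 ^ n)
    (h : 2 ^ N ≤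
      (2 ^ n * (4 * n * (n + (r + 1) + 1) * (r + 1) + 1) ^ (r + 1)) ^ (n + (r + 1) + 1) + 1) :
    N ≤ 8 * n * (n + 2 + r) ^ 2 := by
  have hn2 : n + 1 ≤ 2 ^ n := Nat.lt_two_pow_self
  have hbase : 4 * n * (n + (r + 1) + 1) * (r + 1) + 1 ≤ 2 ^ (7 * n) := by
    calc 4 * n * (n + (r + 1) + 1) * (r + 1) + 1
        ≤ 4 * 2 ^ n * (2 ^ n + 2 ^ n) * 2 ^ n := by
          have : 4 * n * (n + (r + 1) + 1) * (r + 1) ≤ 4 * n * (2 ^ n + 2 ^ n) * 2 ^ n := by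
            have : n + (r + 1) + 1 ≤ 2 ^ n + 2 ^ n := by omega
            exact Nat.mul_le_mul (Nat.mul_le_mul le_rfl this) hr
          have h1 : 1 ≤ 2 ^ n := Nat.one_le_two_pow
          have h2 : 1 ≤ (2 ^ n + 2 ^ n) * 2 ^ n := Nat.mul_pos (by omega) (by omega)
          have h3 : (4 * (n + 1)) * ((2 ^ n + 2 ^ n) * 2 ^ n) ≤
            4 * 2 ^ n * ((2 ^ n + 2 ^ n) * 2 ^ n) := by gcongr
          nlinarith
      _ = 2 ^ (3 * n + 3) := by ring
      _ ≤ 2 ^ (7 * n) := Nat.pow_le_pow_right two_pos (by omega)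
  have hexp : (2 ^ n * (4 * n * (n + (r + 1) + 1) * (r + 1) + 1) ^ (r + 1)) ^ (n + (r + 1) + 1) ≤
      2 ^ (8 * n * (n + 2 + r) ^ 2) := by
    calc _ ≤ (2 ^ n * (2 ^ (7 * n)) ^ (r + 1)) ^ (n + (r + 1) + 1) := by gcongr
      _ = 2 ^ ((n + 7 * n * (r + 1)) * (n + (r + 1) + 1)) := by
        rw [← pow_mul, ← pow_add, ← pow_mul]
      _ ≤ _ := by
        refine Nat.pow_le_pow_right two_pos ?_
        have h1 : n + 7 * n * (r + 1) ≤ 8 * n * (n + 2 + r) := by nlinarith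
        calc _ ≤ 8 * n * (n + 2 + r) * (n + (r + 1) + 1) := by gcongr
          _ = _ := by ring
  by_contra! hlt
  have h1 : 2 ^ (8 * n * (n + 2 + r) ^ 2 + 1) ≤ 2 ^ N := Nat.pow_le_pow_right two_pos hlt
  have hpos : 0 < 8 * n * (n + 2 + r) ^ 2 := by positivity
  have h2 : 2 ^ 1 ≤ 2 ^ (8 * n * (n + 2 + r) ^ 2) := Nat.pow_le_pow_right two_pos hpos
  rw [pow_succ] at h1
  omega

/-- Some sparse paving matroid on `n` elements has large extension complexity. -/
theorem exists_matroid_four_pow_le {n : ℕ} (hn : 2 ≤ n) {r : ℕ} (hr : r + 1 ≤ 2 ^ n)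
    (hlt : 512 * n ^ 5 * (n + 2 + r) ^ 4 < 4 ^ n) :
    ∃ M : Matroid (Fin n), M.E = Set.univ ∧
      r < extensionComplexity (matroidIndependencePolytope M) := by
  by_contra! hall
  obtain ⟨F₀, hF₀, hF₀2, hcard⟩ := exists_large_constantWeight_code n (n / 2) (by omega)
  have h1 := two_pow_card_le_of_extensionComplexity_le (r := r) (by omega) hF₀ fun F hF => by
    obtain ⟨M, hE, hM⟩ := exists_sparsePaving (n := n) (k := n / 2) (by omega) (by omega) F
      (fun S hS => hF₀ S (hF hS)) (fun S hS T hT => hF₀2 S (hF hS) T (hF hT))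
    exact ⟨M, hM, hall M hE⟩
  have h2 := card_le_of_two_pow_card_le (by omega) hr h1
  have h3 := four_pow_le_mul_choose_half_sq n hn
  have h4 : n.choose (n / 2) ≤ n * (8 * n * (n + 2 + r) ^ 2) := hcard.trans (by gcongr)
  have h5 : 4 ^ n ≤ 8 * n * (n * (8 * n * (n + 2 + r) ^ 2)) ^ 2 := h3.trans (by gcongr)
  have : 8 * n * (n * (8 * n * (n + 2 + r) ^ 2)) ^ 2 = 512 * n ^ 5 * (n + 2 + r) ^ 4 := by ring
  omega

/-! ### Asymptotics and choice of constants. -/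

theorem two_rpow_div_pow_four {n : ℕ} :
    ((2 : ℝ) ^ ((n : ℝ) / 2) / (n : ℝ) ^ ((5 : ℝ) / 4)) ^ 4 = 4 ^ n / n ^ 5 := by
  have h1 : ((2 : ℝ) ^ ((n : ℝ) / 2)) ^ 4 = 4 ^ n := by
    rw [← Real.rpow_natCast, ← Real.rpow_mul (by norm_num),
      show (n : ℝ) / 2 * (4 : ℕ) = 2 * n by push_cast; ring, Real.rpow_mul (by norm_num)]
    norm_num
  have h2 : ((n : ℝ) ^ ((5 : ℝ) / 4)) ^ 4 = n ^ 5 := by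
    rw [← Real.rpow_natCast, ← Real.rpow_mul (by positivity), ← Real.rpow_natCast]
    norm_num
  rw [div_pow, h1, h2]

theorem eventually_lt_two_rpow_div : ∀ᶠ n : ℕ in Filter.atTop,
    (n : ℝ) + 2 < (2 : ℝ) ^ ((n : ℝ) / 2) / (n : ℝ) ^ ((5 : ℝ) / 4) / 10 := by
  have h := tendsto_pow_const_div_const_pow_of_one_lt 9 (by norm_num : (1 : ℝ) < 4)
  -- `810000 = 30 ^ 4`, from `10 (n + 2) ≤ 30 n` after taking fourth powers.
  have h2 := h.eventually (gt_mem_nhds (by norm_num : (0 : ℝ) < 1 / 810000))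
  filter_upwards [h2, Filter.eventually_ge_atTop 1] with n hn hn1
  have hn1' : (1 : ℝ) ≤ n := by exact_mod_cast hn1
  rw [lt_div_iff₀ (by norm_num)]
  refine lt_of_pow_lt_pow_left₀ 4 (by positivity) ?_
  rw [two_rpow_div_pow_four, lt_div_iff₀ (by positivity)]
  rw [div_lt_iff₀ (by positivity)] at hn
  calc (((n : ℝ) + 2) * 10) ^ 4 * (n : ℝ) ^ 5 ≤ ((3 * (n : ℝ)) * 10) ^ 4 * (n : ℝ) ^ 5 := by gcongr; linarith
    _ = 810000 * (n : ℝ) ^ 9 := by ring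
    _ < _ := by linarith

theorem exists_matroid_two_rpow_le {n : ℕ} (hn : 2 ≤ n)
    (hlt : (n : ℝ) + 2 < (2 : ℝ) ^ ((n : ℝ) / 2) / (n : ℝ) ^ ((5 : ℝ) / 4) / 10) :
    ∃ M : Matroid (Fin n), M.E = Set.univ ∧
      (2 : ℝ) ^ ((n : ℝ) / 2) / (n : ℝ) ^ ((5 : ℝ) / 4) / 10 ≤
        extensionComplexity (matroidIndependencePolytope M) := by
  have hn1 : (1 : ℝ) ≤ n := by exact_mod_cast (by omega : 1 ≤ n)
  set X := (2 : ℝ) ^ ((n : ℝ) / 2) / (n : ℝ) ^ ((5 : ℝ) / 4) with hX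
  have hX4 : X ^ 4 = 4 ^ n / n ^ 5 := two_rpow_div_pow_four
  have hX0 : 0 < X := by positivity
  have hr : (⌊X / 10⌋₊ : ℝ) ≤ X / 10 := Nat.floor_le (by positivity)
  have hX2 : X ≤ 2 ^ n := by
    calc X ≤ 2 ^ ((n : ℝ) / 2) := div_le_self (by positivity) (Real.one_le_rpow hn1 (by norm_num))
      _ ≤ 2 ^ (n : ℝ) := Real.rpow_le_rpow_of_exponent_le (by norm_num) (by linarith)
      _ = _ := Real.rpow_natCast _ _
  -- With `r = ⌊X / 10⌋₊` one has `n + 2 + r ≤ X / 5`, and the count fails because `512 < 5 ^ 4`.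
  obtain ⟨M, hE, hM⟩ := exists_matroid_four_pow_le hn (r := ⌊X / 10⌋₊) (by
      have : ((⌊X / 10⌋₊ + 1 : ℕ) : ℝ) ≤ (2 ^ n : ℕ) := by
        push_cast
        linarith
      exact_mod_cast this) (by
      have h1 : (n : ℝ) + 2 + ⌊X / 10⌋₊ ≤ X / 5 := by linarith
      have h2 : (512 : ℝ) * n ^ 5 * (n + 2 + ⌊X / 10⌋₊) ^ 4 < 4 ^ n := by
        calc _ ≤ (512 : ℝ) * n ^ 5 * (X / 5) ^ 4 := by gcongr
          _ = 512 / 625 * 4 ^ n := by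
            rw [div_pow, hX4]
            field_simp
            norm_num
          _ < 4 ^ n := by
            have : (0 : ℝ) < 4 ^ n := by positivity
            linarith
      exact_mod_cast h2)
  exact ⟨M, hE, (Nat.lt_floor_add_one _).le.trans (by exact_mod_cast hM)⟩

theorem mainTheorem3 :
    ∃ M : (n : ℕ) → Matroid (Fin n),
      (∀ n, (M n).E = Set.univ) ∧
      ∃ C : ℝ, 0 < C ∧ ∀ n : ℕ, 1 ≤ n →
        C * ((2 : ℝ) ^ ((n : ℝ) / 2) / ((n : ℝ) ^ ((5 : ℝ) / 4) * Real.log (2 * (n : ℝ)))) ≤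
          (extensionComplexity (matroidIndependencePolytope (M n)) : ℝ) := by
  obtain ⟨n₀, hn₀⟩ := Filter.eventually_atTop.1 eventually_lt_two_rpow_div
  -- The factor `2` absorbs `1 / log (2 n) ≤ 2`; the `2 ^ n₀` makes the left side at most `1` for
  -- the small `n`, where the free matroid suffices.
  have key : ∀ n : ℕ, ∃ M : Matroid (Fin n), M.E = Set.univ ∧ (1 ≤ n →
      1 / (20 * 2 ^ n₀) * ((2 : ℝ) ^ ((n : ℝ) / 2) / (n : ℝ) ^ ((5 : ℝ) / 4)) * 2 ≤
        extensionComplexity (matroidIndependencePolytope M)) := by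
    intro n
    by_cases hn : 2 ≤ n ∧ n₀ ≤ n
    · obtain ⟨M, hE, hM⟩ := exists_matroid_two_rpow_le hn.1 (hn₀ n hn.2)
      refine ⟨M, hE, fun _ => le_trans ?_ hM⟩
      have h1 : (1 : ℝ) / (20 * 2 ^ n₀) ≤ 1 / 20 := by
        gcongr
        have : (1 : ℝ) ≤ 2 ^ n₀ := one_le_pow₀ (by norm_num)
        linarith
      have h2 : 0 ≤ (2 : ℝ) ^ ((n : ℝ) / 2) / (n : ℝ) ^ ((5 : ℝ) / 4) := by positivity
      nlinarith
    · refine ⟨Matroid.freeOn Set.univ, rfl, fun hn1 => ?_⟩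
      have hn1' : (1 : ℝ) ≤ n := by exact_mod_cast hn1
      have hle : (n : ℝ) / 2 ≤ (n₀ : ℝ) + 1 := by
        have : n ≤ n₀ + 2 := by omega
        have : (n : ℝ) ≤ n₀ + 2 := by exact_mod_cast this
        have : (0 : ℝ) ≤ n₀ := by positivity
        linarith
      have h1 : (2 : ℝ) ^ ((n : ℝ) / 2) / (n : ℝ) ^ ((5 : ℝ) / 4) ≤ 2 ^ n₀ * 2 := by
        calc _ ≤ (2 : ℝ) ^ ((n : ℝ) / 2) :=
              div_le_self (by positivity) (Real.one_le_rpow hn1' (by norm_num))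
          _ ≤ 2 ^ ((n₀ : ℝ) + 1) := Real.rpow_le_rpow_of_exponent_le (by norm_num) hle
          _ = _ := by rw [Real.rpow_add_one (by norm_num), Real.rpow_natCast]
      have h2 : (1 : ℝ) ≤ extensionComplexity (matroidIndependencePolytope
          (Matroid.freeOn (Set.univ : Set (Fin n)))) := by
        exact_mod_cast one_le_extensionComplexity_freeOn hn1
      refine le_trans ?_ h2
      calc _ ≤ 1 / (20 * 2 ^ n₀) * ((2 : ℝ) ^ n₀ * 2) * 2 := by gcongr
        _ = 1 / 5 := by field_simp; norm_num
        _ ≤ 1 := by norm_num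
  choose M hE hM using key
  refine ⟨M, hE, 1 / (20 * 2 ^ n₀), by positivity, fun n hn => le_trans ?_ (hM n hn)⟩
  have hn1 : (1 : ℝ) ≤ n := by exact_mod_cast hn
  have hlog : 1 / 2 ≤ Real.log (2 * (n : ℝ)) := by
    have h1 := Real.log_two_gt_d9
    have h2 : Real.log 2 ≤ Real.log (2 * (n : ℝ)) := Real.log_le_log two_pos (by linarith)
    linarith
  rw [mul_assoc, ← div_div _ ((n : ℝ) ^ ((5 : ℝ) / 4)) (Real.log _)]
  refine mul_le_mul_of_nonneg_left ?_ (by positivity)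
  rw [div_le_iff₀ (by linarith)]
  have h2 : 0 ≤ (2 : ℝ) ^ ((n : ℝ) / 2) / (n : ℝ) ^ ((5 : ℝ) / 4) := by positivity
  nlinarith
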